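/- A finite simplicial complex is a finite family of finite sets (faces), closed under taking subsets and containing $\emptyset$. For a complex $K$ and a face $\sigma$, $\mathrm{link}_K(\sigma)=\{\tau\in K:\sigma\cap\tau=\emptyset,\ \sigma\cup\tau\in K\}$. If $n=\dim K+1$ is the maximal size of a face and $f_{l-1}$ is the number of faces of size $l$, the $h$-polynomial of $K$ is $h(K,t)=\sum_{m=0}^{n}h_mt^m$ with $h_m=\sum_{l=0}^{m}(-1)^{m-l}\binom{n-l}{m-l}f_{l-1}$. Let $L$ be the triangulation of the $j$-simplex with one interior vertex obtained by starring, i.e. the stellar subdivision of the $j$-simplex at its top face: its vertices are the $j+1$ vertices of the simplex and one further vertex $v$, and its faces are all sets of these vertices that do not contain all $j+1$ vertices of the simplex. Let $\diamondsuit(d)$ be the boundary complex of the $d$-dimensional cross-polytope. A complex $K'$ is a generalized Tchebyshev triangulation of $\diamondsuit(d)$ induced by $L$, written $\diamondsuit(d,L)$, if there are a list $\sigma_1,\dots,\sigma_m$ of the $j$-dimensional faces of $\diamondsuit(d)$, each listed exactly once, and complexes $K_0=\diamondsuit(d),K_1,\dots,K_m=K'$ such that, for every $a\ge 1$, $K_a$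 is obtained from $K_{a-1}$ by replacing the face $\sigma_a$ with an isomorphic copy $L_a$ of $L$ (the vertices of the simplex corresponding to those of $\sigma_a$ and the interior vertex to a new vertex) and the faces $\sigma_a\cup\tau$, $\tau\in\mathrm{link}_{K_{a-1}}(\sigma_a)$, with the faces $\sigma'\cup\tau$, $\sigma'\in L_a$, $\tau\in\mathrm{link}_{K_{a-1}}(\sigma_a)$. For $i\ge 1$ let $P_{0,i}(t)=1$ and, for $d\geq 1$, let $P_{d,i}(t)=(1+t+\dots+t^i)^q(1+t+\dots+t^r)$, where $q\ge0$ and $1\le r\le i$ are the unique integers with $d=qi+r$. Let $g^{(i)}(\diamondsuit(d,L))$ be the vector of coefficients of $h(\diamondsuit(d,L),t)$ with respect to the linearly independent polynomials $t^lP_{d-2l,i}(t)$, $0\le l\le\lfloor d/2\rfloor$. **Statement.** Let $d\ge1$ and $1\le j\le i$ be integers, and let $L$ be the starred $j$-simplex. Then for every generalized Tchebyshev triangulation $\diamondsuit(d,L)$ of $\diamondsuit(d)$ induced by $L$, the vector $g^{(i)}(\diamondsuit(d,L))$ is well defined (the $h$-polynomial has a unique expansion in these polynomials, with integer coefficients),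 and all its entries are nonnegative. -/

import Mathlib

open Polynomial

/-- A finite (abstract) simplicial complex with vertices in `V`: a finite family of finite sets,
closed under taking subsets. The empty set is always a face. The vertices of the complex are those
`v : V` for which `{v}` is a face; `V` itself is only an ambient set of names and may be larger. -/
@[ext]
structure SimplComplex (V : Type*) where
  /-- the faces -/
  faces : Finset (Finset V)
  empty_mem : ∅ ∈ faces
  down_closed : ∀ F ∈ faces, ∀ G, G ⊆ F → G ∈ faces

namespace SimplComplex

/-- `v` is a vertex of `K`. -/
def IsVertex {V : Type*} (K : SimplComplex V) (v : V) : Prop := {v} ∈ K.faces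

/-- `τ` belongs to the link of `σ` in `K`. -/
def InLink {V : Type*} [DecidableEq V] (K : SimplComplex V) (σ τ : Finset V) : Prop :=
  τ ∈ K.faces ∧ Disjoint σ τ ∧ σ ∪ τ ∈ K.faces

/-- The simplex on the vertex set `S`, with all its faces. -/
def simplex {V : Type*} (S : Finset V) : SimplComplex V where
  faces := S.powerset
  empty_mem := by simp
  down_closed := fun F hF G hG =>
    Finset.mem_powerset.2 (hG.trans (Finset.mem_powerset.1 hF))

/-- The image of a complex under a renaming of its vertices. -/
def map {V W : Type*} [DecidableEq W] (e : V ↪ W) (K : SimplComplex V) : SimplComplex W where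
  faces := K.faces.image (fun F => F.map e)
  empty_mem := Finset.mem_image.2 ⟨∅, K.empty_mem, by simp⟩
  down_closed := by
    intro F hF G hG
    obtain ⟨F', hF', rfl⟩ := Finset.mem_image.1 hF
    obtain ⟨G', hG', rfl⟩ := Finset.subset_map_iff.1 hG
    exact Finset.mem_image.2 ⟨G', K.down_closed _ hF' _ hG', rfl⟩

open Classical in
/-- The stellar subdivision of `K` at the nonempty set `F`, with new vertex `v`:
the faces of `K` not containing `F`, together with the join of `{v}`, the boundary complex of `F`
and the link of `F` in `K`. It is meant for `F` a face of `K` and `v` not a vertex of `K`. -/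
noncomputable def stellar {V : Type*} [DecidableEq V] (K : SimplComplex V) (F : Finset V)
    (hF : F.Nonempty) (v : V) : SimplComplex V where
  faces := K.faces.filter (fun T => ¬ F ⊆ T) ∪
    (({v} : Finset V).powerset ×ˢ (F.ssubsets ×ˢ K.faces.filter (fun τ => K.InLink F τ))).image
      (fun p => p.1 ∪ (p.2.1 ∪ p.2.2))
  empty_mem := by
    refine Finset.mem_union_left _ (Finset.mem_filter.2 ⟨K.empty_mem, fun h => ?_⟩)
    exact hF.ne_empty (Finset.subset_empty.1 h)
  down_closed := by
    intro T hT G hG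
    rcases Finset.mem_union.1 hT with hT | hT
    · obtain ⟨hT, hFT⟩ := Finset.mem_filter.1 hT
      exact Finset.mem_union_left _
        (Finset.mem_filter.2 ⟨K.down_closed _ hT _ hG, fun h => hFT (h.trans hG)⟩)
    · obtain ⟨⟨A, ρ, τ⟩, hp, rfl⟩ := Finset.mem_image.1 hT
      simp only [Finset.mem_product, Finset.mem_powerset, Finset.mem_ssubsets,
        Finset.mem_filter] at hp
      obtain ⟨hA, hρ, hτ, -, hd, hu⟩ := hp
      refine Finset.mem_union_right _ (Finset.mem_image.2 ⟨(G ∩ A, G ∩ ρ, G ∩ τ), ?_, ?_⟩)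
      · simp only [Finset.mem_product, Finset.mem_powerset, Finset.mem_ssubsets,
          Finset.mem_filter]
        have hτ' : G ∩ τ ∈ K.faces := K.down_closed _ hτ _ Finset.inter_subset_right
        refine ⟨Finset.inter_subset_right.trans hA,
          lt_of_le_of_lt Finset.inter_subset_right hρ, hτ', hτ', ?_, ?_⟩
        · exact hd.mono_right Finset.inter_subset_right
        · exact K.down_closed _ hu _ (Finset.union_subset_union_right Finset.inter_subset_right)
      · simp only
        rw [← Finset.inter_union_distrib_left, ← Finset.inter_union_distrib_left]
        exact Finset.inter_eq_left.2 hG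

/-- The number of faces with exactly `m` vertices, i.e. `f_{m-1}(K)`. -/
def fNum {V : Type*} (K : SimplComplex V) (m : ℕ) : ℕ :=
  (K.faces.filter (fun F => F.card = m)).card

/-- `dim K + 1`, the largest number of vertices of a face. -/
def dimSucc {V : Type*} (K : SimplComplex V) : ℕ := K.faces.sup Finset.card

/-- The entry `h_m(K) = ∑_{l ≤ m} (-1)^{m-l} C(n-l, m-l) f_{l-1}(K)` of the `h`-vector,
where `n = dim K + 1`. -/
def hNum {V : Type*} (K : SimplComplex V) (m : ℕ) : ℤ :=
  ∑ l ∈ Finset.range (m + 1),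
    (-1 : ℤ) ^ (m - l) * (Nat.choose (K.dimSucc - l) (m - l) : ℤ) * (K.fNum l : ℤ)

/-- The `h`-polynomial of `K`. -/
noncomputable def hPoly {V : Type*} (K : SimplComplex V) : ℤ[X] :=
  ∑ m ∈ Finset.range (K.dimSucc + 1), C (K.hNum m) * X ^ m

/-- The boundary complex of the `d`-dimensional cross-polytope: its vertices are
`(a, true)`, `(a, false)` for `a : Fin d`, and its faces are the sets of vertices containing no
antipodal pair `(a, true)`, `(a, false)`. -/
def crossPolytope (d : ℕ) : SimplComplex (Fin d × Bool) where
  faces := Finset.univ.filter (fun F => ∀ a : Fin d, ¬ ((a, true) ∈ F ∧ (a, false) ∈ F))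
  empty_mem := by simp
  down_closed := by
    intro F hF G hG
    simp only [Finset.mem_filter, Finset.mem_univ, true_and] at hF ⊢
    exact fun a h => hF a ⟨hG h.1, hG h.2⟩

/-- The vertices of the original `j`-simplex inside `starredSimplex j`. -/
def starredBoundary (j : ℕ) : Finset (Option (Fin (j + 1))) :=
  Finset.univ.map Function.Embedding.some

theorem starredBoundary_nonempty (j : ℕ) : (starredBoundary j).Nonempty :=
  Finset.univ_nonempty.map

/-- The triangulation of the `j`-simplex with one interior vertex obtained by starring: the stellar
subdivision of the `j`-simplex (with vertices `some a`) at its top face, the new vertex being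
`none`. -/
noncomputable def starredSimplex (j : ℕ) : SimplComplex (Option (Fin (j + 1))) :=
  stellar (simplex (starredBoundary j)) (starredBoundary j) (starredBoundary_nonempty j) none

/-- Let `L` triangulate a simplex, with `B` the set of vertices of that simplex, the other vertices
of `L` being interior. `K'` is obtained from `K` by replacing `σ` with an isomorphic copy of `L`
(through the vertex map `φ`, which takes `B` onto `σ` and the interior vertices of `L` to new
vertices), and the faces `σ ∪ τ`, `τ` in the link of `σ`, with the faces `σ' ∪ τ`, where `σ'` runs
over the copy of `L`. -/
def IsReplacement {V W : Type*} [DecidableEq V] (L : SimplComplex W) (B : Finset W)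
    (σ : Finset V) (K K' : SimplComplex V) : Prop :=
  ∃ φ : W → V,
    Set.InjOn φ {w | L.IsVertex w} ∧
    B.image φ = σ ∧
    (∀ w, L.IsVertex w → w ∉ B → ¬ K.IsVertex (φ w)) ∧
    ∀ T : Finset V, T ∈ K'.faces ↔
      (T ∈ K.faces ∧ ¬ σ ⊆ T) ∨
      ∃ ρ ∈ L.faces, ∃ τ, K.InLink σ τ ∧ T = ρ.image φ ∪ τ

/-- `K'` is a generalized Tchebyshev triangulation of `K` induced by the triangulation `L` of the
`k`-simplex, where `B` is the set of original vertices of that simplex: the `k`-dimensional faces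
of `K` are listed, each exactly once, as `σ 0, …, σ (m-1)`, and are replaced by copies of `L` in
this order. -/
def IsGenTchebyshev {V W : Type*} [DecidableEq V] (k : ℕ) (L : SimplComplex W) (B : Finset W)
    (K K' : SimplComplex V) : Prop :=
  ∃ (m : ℕ) (σ : Fin m → Finset V) (Ks : Fin (m + 1) → SimplComplex V),
    Function.Injective σ ∧
    (∀ F : Finset V, (∃ a, σ a = F) ↔ F ∈ K.faces ∧ F.card = k + 1) ∧
    Ks 0 = K ∧ Ks (Fin.last m) = K' ∧
    ∀ a : Fin m, IsReplacement L B (σ a) (Ks a.castSucc) (Ks a.succ)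

end SimplComplex

/-- `P_{d,i}(t) = (1 + t + ⋯ + t^i)^q (1 + t + ⋯ + t^r)`, where `d = q i + r` with `q ≥ 0` and
`1 ≤ r ≤ i` (for `d, i ≥ 1`), and `P_{0,i} = 1`. -/
noncomputable def gBasisP (d i : ℕ) : ℤ[X] :=
  if d = 0 then 1
  else (∑ a ∈ Finset.range (i + 1), X ^ a) ^ ((d - 1) / i) *
    ∑ a ∈ Finset.range ((d - 1) % i + 1 + 1), X ^ a

/-- `g` is the vector `g^{(d,i)}(p)` of coefficients of the polynomial `p` in the basis
`t^l P_{d-2l,i}(t)`, `0 ≤ l ≤ ⌊d/2⌋`. -/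
def IsGVector (d i : ℕ) (p : ℤ[X]) (g : Fin (d / 2 + 1) → ℤ) : Prop :=
  p = ∑ l : Fin (d / 2 + 1), C (g l) * (X ^ (l : ℕ) * gBasisP (d - 2 * (l : ℕ)) i)

/-!
Replacing a face `F` by a copy of the starred simplex is a stellar subdivision at `F`, with new
vertex `v`. The faces through `v` are the sets `insert v (G \ B)` with `F ⊆ G` a face and
`∅ ≠ B ⊆ F`, and summing over `B` shows that for every `ρ` avoiding `v` and not containing `F`
the `h`-polynomial of the link of `ρ` grows by `t [|F \ ρ| - 1] h(link (ρ ∪ F))`, where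
`[n] = 1 + t + ⋯ + t^(n-1)`. If `ρ` and `F` are spanned by vertices of the initial complex, so is
`ρ ∪ F`; as all the replaced faces are faces of the initial complex, the links of such sets form a
system that can be followed through all replacements without looking at any other link.

For each `n`, the nonnegative combinations of the `t^l P_{n-2l,i}(t)` form a cone `C_n`.
Multiplication by `t` maps `C_n` into `C_{n+2}`, and multiplication by `[a + 1]`, for `a ≤ i`, maps
it into `C_{n+a}`, because `[k + m] [k + n] = [k + m + n] [k] + t^k [m] [n]`.
Hence nonnegativity for the links of the initial complex is inherited. For the cross-polytope, the
link of a face with `k` vertices has `h`-polynomial `(1 + t)^(d - k)`, a power of `[2]`.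
-/

section GeomSum

variable {R : Type*} [CommSemiring R] (x : R)

/-- The `q`-analogue `1 + x + ⋯ + x ^ (n - 1)` of the natural number `n`. It is the building block
of the polynomials `gBasisP`. -/
def geomSum (n : ℕ) : R := ∑ a ∈ Finset.range n, x ^ a

@[simp] theorem geomSum_zero : geomSum x 0 = 0 := Finset.sum_range_zero _

@[simp] theorem geomSum_one : geomSum x 1 = 1 := by simp [geomSum]

theorem geomSum_add (m n : ℕ) : geomSum x (m + n) = geomSum x m + x ^ m * geomSum x n := by
  simp only [geomSum, Finset.sum_range_add, Finset.mul_sum, pow_add]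

theorem geomSum_succ (n : ℕ) : geomSum x (n + 1) = geomSum x n + x ^ n := by
  simp [geomSum_add]

theorem geomSum_mul_geomSum (k m n : ℕ) :
    geomSum x (k + m) * geomSum x (k + n) =
      geomSum x (k + m + n) * geomSum x k + x ^ k * (geomSum x m * geomSum x n) := by
  have hkm : geomSum x (k + m) = geomSum x m + x ^ m * geomSum x k := by
    rw [add_comm k m, geomSum_add]
  calc geomSum x (k + m) * geomSum x (k + n)
      = geomSum x (k + m) * geomSum x k + x ^ k * geomSum x (k + m) * geomSum x n := by
        rw [geomSum_add x k n]; ring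
    _ = geomSum x (k + m) * geomSum x k +
          x ^ k * (geomSum x m + x ^ m * geomSum x k) * geomSum x n := by rw [← hkm]
    _ = geomSum x (k + m + n) * geomSum x k + x ^ k * (geomSum x m * geomSum x n) := by
        rw [geomSum_add x (k + m) n]; ring

theorem sum_powerset_pow_mul_one_sub_pow {R ι : Type*} [CommRing R]
    (x : R) (S : Finset ι) :
    ∑ B ∈ S.powerset, x ^ (S.card - B.card) * (1 - x) ^ (B.card - 1) =
      geomSum x (S.card + 1) := by
  classical
  induction S using Finset.induction with
  | empty => simp
  | insert a S ha ih =>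
    have hwithout : ∑ B ∈ S.powerset, x ^ (S.card + 1 - B.card) * (1 - x) ^ (B.card - 1) =
        x * geomSum x (S.card + 1) := by
      rw [← ih, Finset.mul_sum]
      refine Finset.sum_congr rfl fun B hB => ?_
      rw [Nat.succ_sub (Finset.card_le_card (Finset.mem_powerset.1 hB)), pow_succ', mul_assoc]
    have hwith : ∑ B ∈ S.powerset, x ^ (S.card + 1 - (insert a B).card) *
        (1 - x) ^ ((insert a B).card - 1) = 1 := by
      calc _ = ∑ B ∈ S.powerset, (1 - x) ^ B.card * x ^ (S.card - B.card) := by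
            refine Finset.sum_congr rfl fun B hB => ?_
            rw [Finset.card_insert_of_notMem fun h => ha (Finset.mem_powerset.1 hB h),
              Nat.add_sub_add_right, Nat.add_sub_cancel, mul_comm]
        _ = 1 := by rw [Finset.sum_pow_mul_eq_add_pow, sub_add_cancel, one_pow]
    rw [Finset.sum_powerset_insert ha, Finset.card_insert_of_notMem ha, hwithout, hwith]
    exact geom_sum_succ.symm

theorem sum_powerset_erase_empty_pow_mul_one_sub_pow {R ι : Type*} [CommRing R] [DecidableEq ι]
    (x : R) (S : Finset ι) :
    ∑ B ∈ S.powerset.erase ∅, x ^ (S.card - B.card) * (1 - x) ^ (B.card - 1) =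
      geomSum x S.card := by
  have h := sum_powerset_pow_mul_one_sub_pow x S
  rw [← Finset.sum_erase_add _ _ (Finset.empty_mem_powerset S), geomSum_succ] at h
  simpa only [Finset.card_empty, Nat.sub_zero, Nat.zero_sub, pow_zero, mul_one,
    add_left_inj] using h

end GeomSum

theorem gBasisP_mul_add {i r : ℕ} (hi : 1 ≤ i) (hr : r ≤ i) (q : ℕ) :
    gBasisP (q * i + r) i = geomSum X (i + 1) ^ q * geomSum X (r + 1) := by
  have euclid : ∀ q' r', r' < i → gBasisP (q' * i + (r' + 1)) i =
      geomSum X (i + 1) ^ q' * geomSum X (r' + 1 + 1) := by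
    intro q' r' hr'
    have hpred : q' * i + (r' + 1) - 1 = r' + i * q' := by rw [mul_comm]; omega
    rw [gBasisP, if_neg (by omega), hpred, Nat.add_mul_div_left _ _ hi, Nat.add_mul_mod_self_left,
      Nat.div_eq_of_lt hr', Nat.mod_eq_of_lt hr', zero_add]
    rfl
  rcases r with _ | r
  · rcases q with _ | q
    · simp [gBasisP]
    · obtain ⟨k, rfl⟩ : ∃ k, i = k + 1 := ⟨i - 1, by omega⟩
      simpa [add_mul, pow_succ] using euclid q k (by omega)
  · exact euclid q r hr

theorem gBasisP_coeff_zero (d i : ℕ) : (gBasisP d i).coeff 0 = 1 := by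
  unfold gBasisP
  split_ifs
  · exact coeff_one_zero
  · rw [coeff_zero_eq_eval_zero, eval_mul, eval_pow, eval_finsetSum, eval_finsetSum,
      Finset.sum_range_succ', Finset.sum_range_succ']
    simp

theorem linearIndependent_X_pow_mul {R : Type*} [Ring R] {n : ℕ} {Q : Fin n → R[X]}
    (hQ : ∀ l, (Q l).coeff 0 = 1) : LinearIndependent R fun l : Fin n => X ^ (l : ℕ) * Q l := by
  rw [Fintype.linearIndependent_iff]
  intro g hg l
  induction l using WellFoundedLT.induction with
  | ind l ih =>
    have hcoeff : ∑ k, g k * (X ^ (k : ℕ) * Q k).coeff l = 0 := by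
      simpa using congrArg (coeff · (l : ℕ)) hg
    rw [Finset.sum_eq_single l] at hcoeff
    · simpa [coeff_X_pow_mul', hQ] using hcoeff
    · intro k _ hkl
      rcases lt_or_gt_of_ne hkl with hkl | hkl
      · rw [ih k hkl, zero_mul]
      · rw [coeff_X_pow_mul', if_neg (by simpa using hkl), mul_zero]
    · simp

theorem IsGVector.unique {i d : ℕ} {p : ℤ[X]} {g g' : Fin (d / 2 + 1) → ℤ}
    (hg : IsGVector d i p g) (hg' : IsGVector d i p g') : g = g' := by
  refine (linearIndependent_X_pow_mul fun l : Fin (d / 2 + 1) =>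
    gBasisP_coeff_zero (d - 2 * (l : ℕ)) i).fintypeLinearCombination_injective ?_
  simpa only [Fintype.linearCombination_apply, smul_eq_C_mul] using hg.symm.trans hg'

/-- The polynomials with a nonnegative `g^{(n,i)}`-vector, that is, the nonnegative integer
combinations of the polynomials `t^l P_{n-2l,i}(t)`. -/
noncomputable def gCone (i n : ℕ) : Submodule ℕ ℤ[X] :=
  Submodule.span ℕ (Set.range fun l : Fin (n / 2 + 1) =>
    X ^ (l : ℕ) * gBasisP (n - 2 * (l : ℕ)) i)

theorem exists_nonneg_isGVector_of_mem_gCone {i n : ℕ} {p : ℤ[X]} (hp : p ∈ gCone i n) :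
    ∃ g, IsGVector n i p g ∧ ∀ l, 0 ≤ g l := by
  obtain ⟨c, rfl⟩ := (Submodule.mem_span_range_iff_exists_fun ℕ).1 hp
  exact ⟨fun l => c l, by simp [IsGVector], fun l => Int.natCast_nonneg _⟩

theorem X_pow_mul_gBasisP_mem_gCone {i l m n : ℕ} (hn : 2 * l + m = n) :
    X ^ l * gBasisP m i ∈ gCone i n := by
  subst hn
  exact Submodule.subset_span ⟨⟨l, by omega⟩, by simp⟩

theorem X_pow_mul_mem_gCone {i l m n : ℕ} {p : ℤ[X]} (hn : 2 * l + m = n) (hp : p ∈ gCone i m) :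
    X ^ l * p ∈ gCone i n := by
  induction hp using Submodule.span_induction with
  | mem p hp =>
    obtain ⟨k, rfl⟩ := hp
    simp only [← mul_assoc, ← pow_add]
    exact X_pow_mul_gBasisP_mem_gCone (by omega)
  | zero => simp
  | add p q _ _ hp hq => rw [mul_add]; exact add_mem hp hq
  | smul c p _ hp => rw [mul_smul_comm]; exact Submodule.smul_mem _ c hp

section GConeMul

variable {i a r q n : ℕ} (hi : 1 ≤ i)

include hi

theorem geomSum_pow_mul_geomSum_mem_gCone (hr : r ≤ i) (hn : q * i + r = n) :
    geomSum X (i + 1) ^ q * geomSum X (r + 1) ∈ gCone i n := by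
  rw [← gBasisP_mul_add hi hr]
  simpa using X_pow_mul_gBasisP_mem_gCone (i := i) (l := 0) (by omega : 2 * 0 + (q * i + r) = n)

theorem geomSum_pow_mul_mul_mem_gCone_of_add_le (har : a + r ≤ i) (hn : q * i + (a + r) = n) :
    geomSum X (i + 1) ^ q * (geomSum X (a + 1) * geomSum X (r + 1)) ∈ gCone i n := by
  induction a generalizing r n with
  | zero => simpa using geomSum_pow_mul_geomSum_mem_gCone hi (by omega : r ≤ i) (by omega)
  | succ a ih =>
    have split : geomSum (X : ℤ[X]) (a + 1 + 1) * geomSum X (r + 1) =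
        geomSum X (a + 1 + r + 1) + X * (geomSum X (a + 1) * geomSum X r) := by
      simpa [add_comm, add_left_comm] using geomSum_mul_geomSum (X : ℤ[X]) 1 (a + 1) r
    rw [split, mul_add]
    refine add_mem (geomSum_pow_mul_geomSum_mem_gCone hi har hn) ?_
    rcases r with _ | r
    · simp
    · have hX := X_pow_mul_mem_gCone (l := 1) (n := n) (by omega)
        (ih (by omega : a + r ≤ i) rfl)
      rwa [pow_one, mul_left_comm] at hX

theorem geomSum_pow_mul_mul_mem_gCone (ha : a ≤ i) (hr : r ≤ i) (hn : q * i + (a + r) = n) :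
    geomSum X (i + 1) ^ q * (geomSum X (a + 1) * geomSum X (r + 1)) ∈ gCone i n := by
  rcases le_total (a + r) i with har | har
  · exact geomSum_pow_mul_mul_mem_gCone_of_add_le hi har hn
  obtain ⟨c, hc⟩ := Nat.exists_eq_add_of_le har
  obtain ⟨u, rfl⟩ : ∃ u, a = c + u := Nat.exists_eq_add_of_le (by omega)
  obtain ⟨w, rfl⟩ : ∃ w, r = c + w := Nat.exists_eq_add_of_le (by omega)
  have split : geomSum (X : ℤ[X]) (c + u + 1) * geomSum X (c + w + 1) =
      geomSum X (i + 1) * geomSum X (c + 1) + X ^ (c + 1) * (geomSum X u * geomSum X w) := by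
    have hiuw : i + 1 = c + 1 + u + w := by omega
    rw [hiuw, add_right_comm c u 1, add_right_comm c w 1, geomSum_mul_geomSum]
  rw [split, mul_add, ← mul_assoc, ← pow_succ]
  refine add_mem (geomSum_pow_mul_geomSum_mem_gCone hi (by omega) (by rw [add_mul]; omega)) ?_
  rcases u with _ | u
  · simp
  rcases w with _ | w
  · simp
  rw [mul_left_comm]
  exact X_pow_mul_mem_gCone (by omega)
    (geomSum_pow_mul_mul_mem_gCone_of_add_le hi (by omega) rfl)

theorem geomSum_mul_mem_gCone {m : ℕ} {p : ℤ[X]} (ha : a ≤ i) (hp : p ∈ gCone i m)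
    (hn : a + m = n) : geomSum X (a + 1) * p ∈ gCone i n := by
  induction hp using Submodule.span_induction with
  | mem p hp =>
    obtain ⟨l, rfl⟩ := hp
    set k := m - 2 * (l : ℕ) with hk
    have hdiv : k / i * i + k % i = k := Nat.div_add_mod' k i
    have hmod : k % i ≤ i := (Nat.mod_lt _ hi).le
    dsimp only
    rw [← hk, ← hdiv, gBasisP_mul_add hi hmod, mul_left_comm, mul_left_comm (geomSum X (a + 1))]
    exact X_pow_mul_mem_gCone (by omega) (geomSum_pow_mul_mul_mem_gCone hi ha hmod rfl)
  | zero => simp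
  | add p q _ _ hp hq => rw [mul_add]; exact add_mem hp hq
  | smul c p _ hp => rw [mul_smul_comm]; exact Submodule.smul_mem _ c hp

theorem one_add_X_pow_mem_gCone (n : ℕ) : (1 + X) ^ n ∈ gCone i n := by
  induction n with
  | zero => simpa [gBasisP] using X_pow_mul_gBasisP_mem_gCone (i := i) (l := 0) (m := 0) rfl
  | succ n ih =>
    have htwo : geomSum (X : ℤ[X]) (1 + 1) = 1 + X := by simp [geomSum_succ]
    rw [pow_succ']
    simpa only [htwo] using geomSum_mul_mem_gCone hi hi ih (add_comm 1 n)

end GConeMul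

theorem X_pow_mul_one_sub_X_pow {R : Type*} [CommRing R] {l n : ℕ} (hln : l ≤ n) :
    (X : R[X]) ^ l * (1 - X) ^ (n - l) =
      ∑ m ∈ Finset.Ico l (n + 1), C ((-1) ^ (m - l) * ((n - l).choose (m - l) : R)) * X ^ m := by
  rw [Finset.sum_Ico_eq_sum_range, Nat.sub_add_comm hln, sub_eq_neg_add, add_pow,
    Finset.mul_sum]
  refine Finset.sum_congr rfl fun k _ => ?_
  simp only [Nat.add_sub_cancel_left, neg_pow (X : R[X]) k, one_pow, pow_add, map_mul, map_pow,
    map_neg, map_one, map_natCast]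
  ring

namespace SimplComplex

variable {V W : Type*}

theorem notMem_of_mem_faces {K : SimplComplex V} {v : V} {T : Finset V} (hv : ¬ K.IsVertex v)
    (hT : T ∈ K.faces) : v ∉ T := fun h =>
  hv (K.down_closed T hT {v} (Finset.singleton_subset_iff.2 h))

theorem card_le_dimSucc {K : SimplComplex V} {T : Finset V} (hT : T ∈ K.faces) :
    T.card ≤ K.dimSucc :=
  Finset.le_sup (f := Finset.card) hT

theorem exists_mem_faces_card_eq_dimSucc (K : SimplComplex V) :
    ∃ T ∈ K.faces, T.card = K.dimSucc := by
  obtain ⟨T, hT, hcard⟩ := Finset.exists_mem_eq_sup K.faces ⟨∅, K.empty_mem⟩ Finset.card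
  exact ⟨T, hT, hcard.symm⟩

theorem sum_faces_eq_sum_fNum {M : Type*} [AddCommMonoid M] (K : SimplComplex V) (f : ℕ → M) :
    ∑ T ∈ K.faces, f T.card = ∑ l ∈ Finset.range (K.dimSucc + 1), K.fNum l • f l := by
  rw [← Finset.sum_fiberwise_of_maps_to' fun T hT =>
    Finset.mem_range.2 (Nat.lt_succ_of_le (card_le_dimSucc hT))]
  simp only [Finset.sum_const, fNum]

theorem dimSucc_map [DecidableEq W] (e : V ↪ W) (K : SimplComplex V) :
    (K.map e).dimSucc = K.dimSucc := by
  simp only [dimSucc, map, Finset.sup_image, Function.comp_def, Finset.card_map]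

variable [DecidableEq V]

section Stellar

variable {K : SimplComplex V} {F T ρ : Finset V} {hF : F.Nonempty} {v : V}

theorem mem_stellar_faces_iff_exists_inLink (hvF : v ∉ F) :
    T ∈ (K.stellar F hF v).faces ↔ (T ∈ K.faces ∧ ¬ F ⊆ T) ∨
      ∃ S ⊆ insert v F, ¬ F ⊆ S ∧ ∃ τ, K.InLink F τ ∧ T = S ∪ τ := by
  simp only [stellar, Finset.mem_union, Finset.mem_filter, Finset.mem_image, Finset.mem_product,
    Finset.mem_powerset, Finset.mem_ssubsets, Prod.exists]
  refine or_congr_right ⟨?_, ?_⟩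
  · rintro ⟨A, S, τ, ⟨hA, hS, -, hτ⟩, rfl⟩
    have hFA : ¬ F ⊆ A ∪ S := fun h => hS.2 fun x hx =>
      (Finset.mem_union.1 (h hx)).resolve_left fun hxA =>
        hvF (Finset.mem_singleton.1 (hA hxA) ▸ hx)
    exact ⟨A ∪ S, Finset.union_subset_union hA hS.1, hFA, τ, hτ, (Finset.union_assoc ..).symm⟩
  · rintro ⟨S, hS, hFS, τ, hτ, rfl⟩
    refine ⟨S ∩ {v}, S ∩ F, τ, ⟨Finset.inter_subset_right, ⟨Finset.inter_subset_right,
      fun h => hFS (h.trans Finset.inter_subset_left)⟩, hτ.1, hτ⟩, ?_⟩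
    rw [← Finset.union_assoc, ← Finset.inter_union_distrib_left, ← Finset.insert_eq,
      Finset.inter_eq_left.2 hS]

theorem mem_stellar_faces (hvF : v ∉ F) :
    T ∈ (K.stellar F hF v).faces ↔
      ¬ F ⊆ T ∧ (T ∈ K.faces ∨ v ∈ T ∧ T.erase v ∪ F ∈ K.faces) := by
  rw [mem_stellar_faces_iff_exists_inLink hvF]
  constructor
  · rintro (⟨hT, hFT⟩ | ⟨S, hS, hFS, τ, ⟨-, hdisj, hFτ⟩, rfl⟩)
    · exact ⟨hFT, Or.inl hT⟩
    have hFT : ¬ F ⊆ S ∪ τ := fun h => hFS (hdisj.left_le_of_le_sup_right h)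
    have herase : (S ∪ τ).erase v ∪ F ⊆ F ∪ τ := by grind
    have hface := K.down_closed _ hFτ _ herase
    by_cases hv : v ∈ S ∪ τ
    · exact ⟨hFT, Or.inr ⟨hv, hface⟩⟩
    · rw [Finset.erase_eq_of_notMem hv] at hface
      exact ⟨hFT, Or.inl (K.down_closed _ hface _ Finset.subset_union_left)⟩
  · rintro ⟨hFT, hT | ⟨hvT, hT⟩⟩
    · exact Or.inl ⟨hT, hFT⟩
    have hlink : K.InLink F (T.erase v \ F) :=
      ⟨K.down_closed _ hT _ (Finset.sdiff_subset.trans Finset.subset_union_left),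
        Finset.disjoint_sdiff, by rwa [Finset.union_sdiff_self_eq_union, Finset.union_comm]⟩
    exact Or.inr ⟨T ∩ insert v F, Finset.inter_subset_right,
      fun h => hFT (h.trans Finset.inter_subset_left), _, hlink, by grind⟩

theorem mem_stellar_simplex_faces (hvF : v ∉ F) :
    T ∈ ((simplex F).stellar F hF v).faces ↔ T ⊆ insert v F ∧ ¬ F ⊆ T := by
  rw [mem_stellar_faces hvF]
  simp only [simplex, Finset.mem_powerset, Finset.union_subset_iff, subset_refl, and_true,
    Finset.subset_insert_iff]
  grind

theorem isVertex_stellar (hvF : v ∉ F) (hcard : 2 ≤ F.card) {u : V} (hu : K.IsVertex u) :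
    (K.stellar F hF v).IsVertex u :=
  (mem_stellar_faces hvF).2 ⟨fun h => by simpa using hcard.trans (Finset.card_le_card h),
    Or.inl hu⟩

theorem insert_sdiff_mem_stellar_faces (hvF : v ∉ F) {G B : Finset V} (hG : G ∈ K.faces)
    (hFG : F ⊆ G) (hBF : B ⊆ F) (hB : B.Nonempty) :
    insert v (G \ B) ∈ (K.stellar F hF v).faces := by
  obtain ⟨b, hb⟩ := hB
  refine (mem_stellar_faces hvF).2 ⟨fun h => ?_, Or.inr ⟨Finset.mem_insert_self .., ?_⟩⟩
  · have := h (hBF hb); grind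
  · exact K.down_closed G hG _ (by grind)

theorem dimSucc_stellar (hv : ¬ K.IsVertex v) (hvF : v ∉ F) :
    (K.stellar F hF v).dimSucc = K.dimSucc := by
  apply le_antisymm
  · refine Finset.sup_le fun T hT => ?_
    obtain ⟨hFT, hT | ⟨hvT, hT⟩⟩ := (mem_stellar_faces hvF).1 hT
    · exact card_le_dimSucc hT
    obtain ⟨x, hxF, hxT⟩ := Finset.not_subset.1 hFT
    calc T.card = (insert x (T.erase v)).card := by
          rw [Finset.card_insert_of_notMem fun h => hxT (Finset.mem_of_mem_erase h),
            Finset.card_erase_add_one hvT]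
      _ ≤ (T.erase v ∪ F).card := Finset.card_le_card (by grind)
      _ ≤ K.dimSucc := card_le_dimSucc hT
  · obtain ⟨T, hT, hcard⟩ := K.exists_mem_faces_card_eq_dimSucc
    rw [← hcard]
    by_cases hFT : F ⊆ T
    · obtain ⟨x, hx⟩ := hF
      have hvT : v ∉ T \ {x} := fun h => notMem_of_mem_faces hv hT (Finset.sdiff_subset h)
      calc T.card = (insert v (T \ {x})).card := by
            rw [Finset.card_insert_of_notMem hvT, Finset.sdiff_singleton_eq_erase,
              Finset.card_erase_add_one (hFT hx)]
        _ ≤ (K.stellar F _ v).dimSucc := card_le_dimSucc <|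
            insert_sdiff_mem_stellar_faces hvF hT hFT (Finset.singleton_subset_iff.2 hx)
              (Finset.singleton_nonempty x)
    · exact card_le_dimSucc ((mem_stellar_faces hvF).2 ⟨hFT, Or.inl hT⟩)

end Stellar

theorem notMem_image_of_injOn_insert [DecidableEq W] {φ : W → V} {B : Finset W} {w : W}
    (hφ : Set.InjOn φ (insert w B : Finset W)) (hwB : w ∉ B) : φ w ∉ B.image φ := by
  intro hmem
  obtain ⟨u, hu, huw⟩ := Finset.mem_image.1 hmem
  exact hwB (hφ (Finset.mem_insert_of_mem hu) (Finset.mem_insert_self w B) huw ▸ hu)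

theorem mem_stellar_simplex_image_faces [DecidableEq W] {φ : W → V} {B : Finset W}
    {hB : B.Nonempty} {w : W} {S : Finset V} (hwB : w ∉ B)
    (hφ : Set.InjOn φ (insert w B : Finset W)) :
    S ∈ ((simplex (B.image φ)).stellar (B.image φ) (hB.image φ) (φ w)).faces ↔
      ∃ ρ ∈ ((simplex B).stellar B hB w).faces, ρ.image φ = S := by
  have hwφ : φ w ∉ B.image φ := notMem_image_of_injOn_insert hφ hwB
  have hsub : ∀ ρ ⊆ insert w B, B.image φ ⊆ ρ.image φ ↔ B ⊆ ρ := by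
    intro ρ hρ
    rw [← Finset.coe_subset, Finset.coe_image, Finset.coe_image, hφ.image_subset_image_iff
      (Finset.coe_subset.2 (Finset.subset_insert w B)) (Finset.coe_subset.2 hρ), Finset.coe_subset]
  rw [mem_stellar_simplex_faces hwφ, ← Finset.image_insert, Finset.subset_image_iff]
  simp only [mem_stellar_simplex_faces hwB]
  constructor
  · rintro ⟨⟨ρ, hρ, rfl⟩, hBρ⟩
    exact ⟨ρ, ⟨hρ, (hsub ρ hρ).not.1 hBρ⟩, rfl⟩
  · rintro ⟨ρ, ⟨hρ, hBρ⟩, rfl⟩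
    exact ⟨⟨ρ, hρ, rfl⟩, (hsub ρ hρ).not.2 hBρ⟩

theorem IsReplacement.exists_eq_stellar [DecidableEq W] {B : Finset W} {hB : B.Nonempty} {w : W}
    {σ : Finset V} {K K' : SimplComplex V} (hwB : w ∉ B) (hcard : 2 ≤ B.card)
    (h : IsReplacement ((simplex B).stellar B hB w) B σ K K') :
    ∃ (hσ : σ.Nonempty) (v : V), ¬ K.IsVertex v ∧ v ∉ σ ∧ K' = K.stellar σ hσ v := by
  obtain ⟨φ, hinj, rfl, hnew, hfaces⟩ := h
  have hvert : ∀ u ∈ insert w B, ((simplex B).stellar B hB w).IsVertex u := fun u hu =>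
    (mem_stellar_simplex_faces hwB).2 ⟨Finset.singleton_subset_iff.2 hu,
      fun h => by simpa using hcard.trans (Finset.card_le_card h)⟩
  have hφ : Set.InjOn φ (insert w B : Finset W) := hinj.mono hvert
  have hwφ : φ w ∉ B.image φ := notMem_image_of_injOn_insert hφ hwB
  refine ⟨hB.image φ, φ w, hnew w (hvert w (Finset.mem_insert_self w B)) hwB, hwφ, ?_⟩
  ext T
  rw [hfaces, mem_stellar_faces_iff_exists_inLink hwφ]
  refine or_congr_right ⟨?_, ?_⟩
  · rintro ⟨ρ, hρ, hτ⟩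
    obtain ⟨hS, hBS⟩ := (mem_stellar_simplex_faces hwφ).1
      ((mem_stellar_simplex_image_faces hwB hφ).2 ⟨ρ, hρ, rfl⟩)
    exact ⟨ρ.image φ, hS, hBS, hτ⟩
  · rintro ⟨S, hS, hBS, hτ⟩
    obtain ⟨ρ, hρ, rfl⟩ := (mem_stellar_simplex_image_faces (hB := hB) hwB hφ).1
      ((mem_stellar_simplex_faces hwφ).2 ⟨hS, hBS⟩)
    exact ⟨ρ, hρ, hτ⟩

/-- The `h`-polynomial of the link of the face `ρ` of `K`, where the link is given the dimension
`K.dimSucc - ρ.card - 1` that it has when `K` is pure. The link is described by the faces of `K`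
containing `ρ`, so the value is `0` when `ρ` is not a face. -/
noncomputable def linkHPoly (K : SimplComplex V) (ρ : Finset V) : ℤ[X] :=
  ∑ T ∈ K.faces with ρ ⊆ T, X ^ (T \ ρ).card * (1 - X) ^ (K.dimSucc - T.card)

theorem hPoly_eq_linkHPoly_empty (K : SimplComplex V) : K.hPoly = K.linkHPoly ∅ := by
  set n := K.dimSucc with hn
  calc K.hPoly
      = ∑ m ∈ Finset.range (n + 1), ∑ l ∈ Finset.range (m + 1),
          K.fNum l • (C ((-1) ^ (m - l) * ((n - l).choose (m - l) : ℤ)) * X ^ m) := by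
        simp only [hPoly, hNum, map_sum, Finset.sum_mul, ← hn]
        refine Finset.sum_congr rfl fun m _ => Finset.sum_congr rfl fun l _ => ?_
        simp only [map_mul, map_natCast, nsmul_eq_mul]
        ring
    _ = ∑ l ∈ Finset.range (n + 1), K.fNum l • (X ^ l * (1 - X) ^ (n - l)) := by
        simp only [Finset.range_eq_Ico]
        rw [← Finset.sum_Ico_Ico_comm]
        refine Finset.sum_congr rfl fun l hl => ?_
        rw [X_pow_mul_one_sub_X_pow (Nat.le_of_lt_succ (Finset.mem_Ico.1 hl).2), Finset.smul_sum]
    _ = K.linkHPoly ∅ := by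
        rw [← K.sum_faces_eq_sum_fNum fun l => (X : ℤ[X]) ^ l * (1 - X) ^ (n - l)]
        simp only [linkHPoly, Finset.empty_subset, Finset.filter_true, Finset.sdiff_empty, hn]

theorem linkHPoly_eq_zero_of_notMem {K : SimplComplex V} {ρ : Finset V} (hρ : ρ ∉ K.faces) :
    K.linkHPoly ρ = 0 := by
  refine Finset.sum_eq_zero fun T hT => ?_
  obtain ⟨hT, hρT⟩ := Finset.mem_filter.1 hT
  exact absurd (K.down_closed T hT ρ hρT) hρ

theorem linkHPoly_map [DecidableEq W] (e : V ↪ W) (K : SimplComplex V) (ρ : Finset V) :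
    (K.map e).linkHPoly (ρ.map e) = K.linkHPoly ρ := by
  rw [linkHPoly, dimSucc_map, map, Finset.filter_image,
    Finset.sum_image fun _ _ _ _ h => Finset.map_injective e h]
  simp only [Finset.map_subset_map, ← Finset.map_sdiff, Finset.card_map, linkHPoly]

theorem card_sdiff_eq_add_card_sdiff_union {F G : Finset V} (hFG : F ⊆ G) (ρ : Finset V) :
    (G \ ρ).card = (F \ ρ).card + (G \ (ρ ∪ F)).card := by
  have hdiff : G \ (ρ ∪ F) = (G \ ρ) \ (F \ ρ) := by grind
  rw [hdiff, add_comm, Finset.card_sdiff_add_card_eq_card (Finset.sdiff_subset_sdiff hFG le_rfl)]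

theorem linkHPoly_eq_sum_not_subset_add (K : SimplComplex V) (ρ F : Finset V) :
    K.linkHPoly ρ =
      ∑ T ∈ K.faces with ρ ⊆ T ∧ ¬ F ⊆ T, X ^ (T \ ρ).card * (1 - X) ^ (K.dimSucc - T.card) +
        X ^ (F \ ρ).card * K.linkHPoly (ρ ∪ F) := by
  rw [linkHPoly, ← Finset.sum_filter_not_add_sum_filter _ (fun T => F ⊆ T), Finset.filter_filter,
    Finset.filter_filter, linkHPoly, Finset.mul_sum]
  simp only [Finset.union_subset_iff]
  refine congrArg _ (Finset.sum_congr rfl fun T hT => ?_)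
  have hFT := (Finset.mem_filter.1 hT).2.2
  rw [card_sdiff_eq_add_card_sdiff_union hFT, pow_add, mul_assoc]

section Stellar

variable {K : SimplComplex V} {F ρ : Finset V} {hF : F.Nonempty} {v : V}

theorem filter_mem_stellar_faces (hv : ¬ K.IsVertex v) (hvF : v ∉ F) (hvρ : v ∉ ρ) :
    {T ∈ (K.stellar F hF v).faces | ρ ⊆ T ∧ v ∈ T} =
      ({G ∈ K.faces | ρ ∪ F ⊆ G} ×ˢ (F \ ρ).powerset.erase ∅).image
        fun p => insert v (p.1 \ p.2) := by
  ext T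
  simp only [Finset.mem_filter, Finset.mem_image, Finset.mem_product, Finset.mem_erase,
    Finset.mem_powerset, Prod.exists]
  constructor
  · rintro ⟨hT, hρT, hvT⟩
    obtain ⟨hFT, hT | ⟨-, hT⟩⟩ := (mem_stellar_faces hvF).1 hT
    · exact absurd hvT (notMem_of_mem_faces hv hT)
    have hFT' : F \ T ≠ ∅ := (Finset.sdiff_nonempty.2 hFT).ne_empty
    exact ⟨T.erase v ∪ F, F \ T, ⟨⟨hT, by grind⟩, hFT', by grind⟩, by grind⟩
  · rintro ⟨G, B, ⟨⟨hG, hρFG⟩, hB, hBF⟩, rfl⟩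
    exact ⟨insert_sdiff_mem_stellar_faces hvF hG (Finset.union_subset_right hρFG)
      (hBF.trans Finset.sdiff_subset) (Finset.nonempty_iff_ne_empty.2 hB), by grind, by grind⟩

theorem injOn_insert_sdiff (hv : ¬ K.IsVertex v) (hvF : v ∉ F) :
    Set.InjOn (fun p : Finset V × Finset V => insert v (p.1 \ p.2))
      ({G ∈ K.faces | ρ ∪ F ⊆ G} ×ˢ (F \ ρ).powerset.erase ∅ : Finset (Finset V × Finset V)) := by
  refine Set.LeftInvOn.injOn (f₁' := fun T => (T.erase v ∪ F, F \ T)) ?_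
  rintro ⟨G, B⟩ hGB
  simp only [Finset.mem_coe, Finset.mem_product, Finset.mem_filter, Finset.mem_erase,
    Finset.mem_powerset] at hGB
  obtain ⟨⟨hG, hρFG⟩, -, hBF⟩ := hGB
  have hvG := notMem_of_mem_faces hv hG
  exact Prod.ext (by grind) (by grind)

theorem card_insert_sdiff_add {G B : Finset V} (hvG : v ∉ G) (hBG : B ⊆ G) :
    (insert v (G \ B)).card + B.card = G.card + 1 := by
  rw [Finset.card_insert_of_notMem fun h => hvG (Finset.sdiff_subset h), add_right_comm,
    Finset.card_sdiff_add_card_eq_card hBG]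

theorem pow_card_insert_sdiff_mul {R : Type*} [CommRing R] {G B : Finset V} {n : ℕ} (x : R)
    (hvG : v ∉ G) (hvρ : v ∉ ρ) (hFG : F ⊆ G) (hB : B ≠ ∅) (hBF : B ⊆ F \ ρ) (hn : G.card ≤ n) :
    x ^ (insert v (G \ B) \ ρ).card * (1 - x) ^ (n - (insert v (G \ B)).card) =
      x * (x ^ ((F \ ρ).card - B.card) * (1 - x) ^ (B.card - 1)) *
        (x ^ (G \ (ρ ∪ F)).card * (1 - x) ^ (n - G.card)) := by
  have hcomm : insert v (G \ B) \ ρ = insert v ((G \ ρ) \ B) := by grind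
  have hcardρ := card_insert_sdiff_add (v := v) (G := G \ ρ) (B := B) (by grind) (by grind)
  have hcard := card_insert_sdiff_add (v := v) (G := G) (B := B) hvG (by grind)
  have hGρ := card_sdiff_eq_add_card_sdiff_union hFG ρ
  have hBcard := Finset.card_le_card hBF
  have hBpos := Finset.card_pos.2 (Finset.nonempty_iff_ne_empty.2 hB)
  have hxexp : (insert v (G \ B) \ ρ).card =
      1 + ((F \ ρ).card - B.card) + (G \ (ρ ∪ F)).card := by
    rw [hcomm]; omega
  have hyexp : n - (insert v (G \ B)).card = (B.card - 1) + (n - G.card) := by omega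
  rw [hxexp, hyexp]
  ring

theorem sum_mem_stellar_faces (hv : ¬ K.IsVertex v) (hvF : v ∉ F) (hvρ : v ∉ ρ) :
    ∑ T ∈ (K.stellar F hF v).faces with ρ ⊆ T ∧ v ∈ T,
        (X : ℤ[X]) ^ (T \ ρ).card * (1 - X) ^ (K.dimSucc - T.card) =
      X * geomSum X (F \ ρ).card * K.linkHPoly (ρ ∪ F) := by
  rw [filter_mem_stellar_faces hv hvF hvρ, Finset.sum_image (injOn_insert_sdiff hv hvF),
    ← sum_powerset_erase_empty_pow_mul_one_sub_pow, Finset.mul_sum, linkHPoly, Finset.sum_mul_sum,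
    Finset.sum_comm, ← Finset.sum_product']
  refine Finset.sum_congr rfl fun p hp => ?_
  simp only [Finset.mem_product, Finset.mem_filter, Finset.mem_erase, Finset.mem_powerset] at hp
  obtain ⟨⟨hG, hρFG⟩, hB, hBF⟩ := hp
  exact pow_card_insert_sdiff_mul X (notMem_of_mem_faces hv hG) hvρ
    (Finset.union_subset_right hρFG) hB hBF (card_le_dimSucc hG)

theorem linkHPoly_stellar (hv : ¬ K.IsVertex v) (hvF : v ∉ F) (hvρ : v ∉ ρ) (hFρ : ¬ F ⊆ ρ) :
    (K.stellar F hF v).linkHPoly ρ =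
      K.linkHPoly ρ + X * geomSum X ((F \ ρ).card - 1) * K.linkHPoly (ρ ∪ F) := by
  obtain ⟨k, hk⟩ := Nat.exists_eq_add_of_lt (Finset.card_pos.2 (Finset.sdiff_nonempty.2 hFρ))
  rw [zero_add] at hk
  have hold : {T ∈ (K.stellar F hF v).faces | ρ ⊆ T ∧ v ∉ T} =
      {T ∈ K.faces | ρ ⊆ T ∧ ¬ F ⊆ T} := by
    ext T
    have hvT : T ∈ K.faces → v ∉ T := notMem_of_mem_faces hv
    simp only [Finset.mem_filter, mem_stellar_faces hvF]
    tauto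
  rw [K.linkHPoly_eq_sum_not_subset_add ρ F, linkHPoly, dimSucc_stellar hv hvF,
    ← Finset.sum_filter_not_add_sum_filter _ (fun T => v ∈ T), Finset.filter_filter,
    Finset.filter_filter, sum_mem_stellar_faces hv hvF hvρ, hold, hk, Nat.add_sub_cancel,
    geomSum_succ]
  ring

end Stellar

theorem linkHPoly_stellar_mem_gCone {K : SimplComplex V} {F ρ : Finset V} {hF : F.Nonempty} {v : V}
    {i : ℕ} (hi : 1 ≤ i) (hFi : F.card ≤ i + 1) (hv : ¬ K.IsVertex v) (hvF : v ∉ F) (hvρ : v ∉ ρ)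
    (hρ : K.linkHPoly ρ ∈ gCone i (K.dimSucc - ρ.card))
    (hρF : K.linkHPoly (ρ ∪ F) ∈ gCone i (K.dimSucc - (ρ ∪ F).card)) :
    (K.stellar F hF v).linkHPoly ρ ∈ gCone i (K.dimSucc - ρ.card) := by
  by_cases hFρ : F ⊆ ρ
  · rw [linkHPoly_eq_zero_of_notMem fun hmem => ((mem_stellar_faces hvF).1 hmem).1 hFρ]
    exact zero_mem _
  rw [linkHPoly_stellar hv hvF hvρ hFρ]
  refine add_mem hρ ?_
  by_cases hface : ρ ∪ F ∈ K.faces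
  · have hle := card_le_dimSucc hface
    have hcard : (F \ ρ).card + ρ.card = (ρ ∪ F).card := by
      rw [Finset.card_sdiff_add_card, Finset.union_comm]
    have hcardF : (F \ ρ).card ≤ F.card := Finset.card_le_card Finset.sdiff_subset
    rcases hk : (F \ ρ).card - 1 with _ | a
    · simp
    · have hmul := geomSum_mul_mem_gCone (a := a) hi (by omega) hρF rfl
      simpa only [pow_one, mul_assoc] using X_pow_mul_mem_gCone (l := 1) (by omega) hmul
  · rw [linkHPoly_eq_zero_of_notMem hface, mul_zero]
    exact zero_mem _

/-- The invariant maintained by the successive replacements: `K` has dimension `d - 1`, it still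
has the vertices in `U`, and the links of the faces spanned by `U` have nonnegative
`g^{(i)}`-vectors. Nothing is claimed about links of faces that involve other vertices. -/
structure LinksInGCone (i d : ℕ) (U : Set V) (K : SimplComplex V) : Prop where
  dimSucc_eq : K.dimSucc = d
  isVertex : ∀ u ∈ U, K.IsVertex u
  linkHPoly_mem : ∀ ρ : Finset V, (ρ : Set V) ⊆ U → K.linkHPoly ρ ∈ gCone i (d - ρ.card)

namespace LinksInGCone

variable {i d : ℕ} {U : Set V} {K : SimplComplex V}

theorem hPoly_mem_gCone (hK : LinksInGCone i d U K) : K.hPoly ∈ gCone i d := by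
  simpa [hPoly_eq_linkHPoly_empty] using hK.linkHPoly_mem ∅ (by simp)

theorem stellar (hK : LinksInGCone i d U K) {F : Finset V} {hF : F.Nonempty} {v : V}
    (hv : ¬ K.IsVertex v) (hvF : v ∉ F) (hFU : (F : Set V) ⊆ U) (hF2 : 2 ≤ F.card)
    (hFi : F.card ≤ i + 1) : LinksInGCone i d U (K.stellar F hF v) := by
  obtain ⟨rfl, hvert, hcone⟩ := hK
  refine ⟨dimSucc_stellar hv hvF, fun u hu => isVertex_stellar hvF hF2 (hvert u hu),
    fun ρ hρU => ?_⟩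
  have hvρ : v ∉ ρ := fun h => hv (hvert v (hρU h))
  refine linkHPoly_stellar_mem_gCone (by omega) hFi hv hvF hvρ (hcone ρ hρU) (hcone (ρ ∪ F) ?_)
  rw [Finset.coe_union]
  exact Set.union_subset hρU hFU

end LinksInGCone

namespace IsGenTchebyshev

variable {K K' : SimplComplex V}

theorem induction {k : ℕ} {L : SimplComplex W} {B : Finset W}
    {P : SimplComplex V → Prop} (h : IsGenTchebyshev k L B K K') (base : P K)
    (step : ∀ σ ∈ K.faces, σ.card = k + 1 →
      ∀ K₁ K₂, IsReplacement L B σ K₁ K₂ → P K₁ → P K₂) : P K' := by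
  obtain ⟨m, σ, Ks, -, hσ, hfirst, hlast, hstep⟩ := h
  suffices ∀ b, P (Ks b) from hlast ▸ this (Fin.last m)
  intro b
  induction b using Fin.induction with
  | zero => exact hfirst ▸ base
  | succ a ih =>
    obtain ⟨hface, hcard⟩ := (hσ (σ a)).1 ⟨a, rfl⟩
    exact step (σ a) hface hcard _ _ (hstep a) ih

theorem linksInGCone {d i j : ℕ} (hj : 1 ≤ j) (hji : j ≤ i)
    (h : IsGenTchebyshev j (starredSimplex j) (starredBoundary j) K K')
    (hK : LinksInGCone i d {u | K.IsVertex u} K) : LinksInGCone i d {u | K.IsVertex u} K' := by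
  refine h.induction hK fun σ hσ hcard K₁ K₂ hrepl hK₁ => ?_
  obtain ⟨_, v, hv, hvσ, rfl⟩ := hrepl.exists_eq_stellar (by simp [starredBoundary])
    (by simpa [starredBoundary] using hj)
  have hσU : (σ : Set V) ⊆ {u | K.IsVertex u} := fun u hu =>
    K.down_closed σ hσ {u} (Finset.singleton_subset_iff.2 hu)
  exact hK₁.stellar hv hvσ hσU (by omega) (by omega)

end IsGenTchebyshev

section CrossPolytope

variable {d : ℕ}

/-- A set of vertices of the cross-polytope, viewed as the choice of a set of signs in each
coordinate. -/
def signsEquiv (d : ℕ) : Finset (Fin d × Bool) ≃ (Fin d → Finset Bool) where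
  toFun T a := {b | (a, b) ∈ T}
  invFun s := {p | p.2 ∈ s p.1}
  left_inv T := by ext; simp
  right_inv s := by ext; simp

@[simp] theorem mem_signsEquiv {T : Finset (Fin d × Bool)} {a : Fin d} {b : Bool} :
    b ∈ signsEquiv d T a ↔ (a, b) ∈ T := by
  simp [signsEquiv]

theorem sum_card_signsEquiv (T : Finset (Fin d × Bool)) :
    ∑ a, (signsEquiv d T a).card = T.card := by
  simp only [signsEquiv, Equiv.coe_fn_mk, Finset.card_filter]
  rw [← Fintype.sum_prod_type (f := fun p : Fin d × Bool => if p ∈ T then 1 else 0)]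
  simp

theorem signsEquiv_sdiff (T ρ : Finset (Fin d × Bool)) (a : Fin d) :
    signsEquiv d (T \ ρ) a = signsEquiv d T a \ signsEquiv d ρ a := by
  ext; simp

theorem subset_iff_signsEquiv_subset {ρ T : Finset (Fin d × Bool)} :
    ρ ⊆ T ↔ ∀ a, signsEquiv d ρ a ⊆ signsEquiv d T a := by
  simp only [Finset.subset_iff, mem_signsEquiv, Prod.forall]

theorem mem_crossPolytope_faces {T : Finset (Fin d × Bool)} :
    T ∈ (crossPolytope d).faces ↔ ∀ a, (signsEquiv d T a).card ≤ 1 := by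
  have card_le_one_iff : ∀ s : Finset Bool, s.card ≤ 1 ↔ ¬ (true ∈ s ∧ false ∈ s) := by decide
  simp only [crossPolytope, Finset.mem_filter, Finset.mem_univ, true_and, card_le_one_iff,
    mem_signsEquiv]

theorem dimSucc_crossPolytope (d : ℕ) : (crossPolytope d).dimSucc = d := by
  apply le_antisymm
  · refine Finset.sup_le fun T hT => ?_
    calc T.card = ∑ a, (signsEquiv d T a).card := (sum_card_signsEquiv T).symm
      _ ≤ ∑ _ : Fin d, 1 := Finset.sum_le_sum fun a _ => mem_crossPolytope_faces.1 hT a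
      _ = d := by simp
  · have hface : Finset.univ.map (Function.Embedding.sectL (Fin d) true) ∈
        (crossPolytope d).faces := by simp [crossPolytope]
    simpa using card_le_dimSucc hface

theorem sum_one_sub_card_signsEquiv {T : Finset (Fin d × Bool)}
    (hT : T ∈ (crossPolytope d).faces) : ∑ a, (1 - (signsEquiv d T a).card) = d - T.card := by
  rw [Finset.sum_tsub_distrib _ fun a _ => mem_crossPolytope_faces.1 hT a, sum_card_signsEquiv]
  simp

theorem sum_pow_card_sdiff_mul_of_card_le_one {R : Type*} [CommRing R] (x : R) {r : Finset Bool}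
    (hr : r.card ≤ 1) :
    ∑ s : Finset Bool with s.card ≤ 1 ∧ r ⊆ s, x ^ (s \ r).card * (1 - x) ^ (1 - s.card) =
      (1 + x) ^ (1 - r.card) := by
  obtain rfl | ⟨b, rfl⟩ : r = ∅ ∨ ∃ b, r = {b} := by
    simpa only [Finset.card_le_one_iff_subset_singleton, Finset.subset_singleton_iff,
      exists_or, exists_const] using hr
  · have hsigns : ({s | s.card ≤ 1 ∧ ∅ ⊆ s} : Finset (Finset Bool)) =
        {∅, {true}, {false}} := by decide
    rw [hsigns, Finset.sum_insert (by decide), Finset.sum_insert (by decide),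
      Finset.sum_singleton]
    simp
  · have hsigns : ({s | s.card ≤ 1 ∧ {b} ⊆ s} : Finset (Finset Bool)) = {{b}} := by
      revert b; decide
    rw [hsigns]
    simp

theorem linkHPoly_crossPolytope {ρ : Finset (Fin d × Bool)} (hρ : ρ ∈ (crossPolytope d).faces) :
    (crossPolytope d).linkHPoly ρ = (1 + X) ^ (d - ρ.card) := by
  calc (crossPolytope d).linkHPoly ρ
      = ∑ s ∈ Fintype.piFinset fun a =>
            ({s | s.card ≤ 1 ∧ signsEquiv d ρ a ⊆ s} : Finset (Finset Bool)),
          ∏ a, X ^ (s a \ signsEquiv d ρ a).card * (1 - X) ^ (1 - (s a).card) := by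
        rw [linkHPoly, dimSucc_crossPolytope]
        refine Finset.sum_equiv (signsEquiv d) (fun T => ?_) fun T hT => ?_
        · simp only [Finset.mem_filter, mem_crossPolytope_faces, subset_iff_signsEquiv_subset,
            Fintype.mem_piFinset, Finset.mem_univ, true_and, forall_and]
        · rw [Finset.prod_mul_distrib, Finset.prod_pow_eq_pow_sum, Finset.prod_pow_eq_pow_sum,
            sum_one_sub_card_signsEquiv (Finset.mem_filter.1 hT).1, ← sum_card_signsEquiv (T \ ρ)]
          simp only [signsEquiv_sdiff]
    _ = ∏ a, (1 + X) ^ (1 - (signsEquiv d ρ a).card) := by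
        simp only [← sum_pow_card_sdiff_mul_of_card_le_one (X : ℤ[X])
          (mem_crossPolytope_faces.1 hρ _), Finset.prod_univ_sum]
    _ = (1 + X) ^ (d - ρ.card) := by
        rw [Finset.prod_pow_eq_pow_sum, sum_one_sub_card_signsEquiv hρ]

theorem linkHPoly_map_crossPolytope_mem_gCone {i : ℕ} (hi : 1 ≤ i)
    (e : Fin d × Bool ↪ V) {ρ : Finset V} (hρ : ρ ∈ ((crossPolytope d).map e).faces) :
    ((crossPolytope d).map e).linkHPoly ρ ∈ gCone i (d - ρ.card) := by
  obtain ⟨ρ, hρ', rfl⟩ := Finset.mem_image.1 hρ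
  rw [linkHPoly_map, linkHPoly_crossPolytope hρ', Finset.card_map]
  exact one_add_X_pow_mem_gCone hi _

end CrossPolytope

end SimplComplex

theorem mainTheorem9_general {V : Type*} [DecidableEq V] {d i j : ℕ} (hj : 1 ≤ j) (hji : j ≤ i)
    {K K' : SimplComplex V} (hd : K.dimSucc = d)
    (hK : ∀ ρ ∈ K.faces, K.linkHPoly ρ ∈ gCone i (d - ρ.card))
    (hK' : SimplComplex.IsGenTchebyshev j (SimplComplex.starredSimplex j)
      (SimplComplex.starredBoundary j) K K') :
    (∃! g : Fin (d / 2 + 1) → ℤ, IsGVector d i K'.hPoly g) ∧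
      ∀ g : Fin (d / 2 + 1) → ℤ, IsGVector d i K'.hPoly g → ∀ l, 0 ≤ g l := by
  have hlinks : SimplComplex.LinksInGCone i d {u | K.IsVertex u} K :=
    ⟨hd, fun _ hu => hu, fun ρ _ => by
      by_cases hρ : ρ ∈ K.faces
      · exact hK ρ hρ
      · rw [SimplComplex.linkHPoly_eq_zero_of_notMem hρ]
        exact zero_mem _⟩
  obtain ⟨g, hg, hg_nonneg⟩ := exists_nonneg_isGVector_of_mem_gCone
    (hK'.linksInGCone hj hji hlinks).hPoly_mem_gCone
  exact ⟨⟨g, hg, fun _ hg' => hg'.unique hg⟩, fun _ hg' => hg'.unique hg ▸ hg_nonneg⟩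

theorem mainTheorem9 {V : Type*} [DecidableEq V] (d i j : ℕ) (hd : 1 ≤ d)
    (hj : 1 ≤ j) (hji : j ≤ i) (e : Fin d × Bool ↪ V) (K' : SimplComplex V)
    (hK' : SimplComplex.IsGenTchebyshev j (SimplComplex.starredSimplex j)
      (SimplComplex.starredBoundary j) ((SimplComplex.crossPolytope d).map e) K') :
    (∃! g : Fin (d / 2 + 1) → ℤ, IsGVector d i K'.hPoly g) ∧
      ∀ g : Fin (d / 2 + 1) → ℤ, IsGVector d i K'.hPoly g → ∀ l, 0 ≤ g l := by
  exact mainTheorem9_general hj hji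
    ((SimplComplex.dimSucc_map e _).trans (SimplComplex.dimSucc_crossPolytope d))
    (fun _ => SimplComplex.linkHPoly_map_crossPolytope_mem_gCone (hj.trans hji) e) hK'
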